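/- Let $X$ be a compact Hausdorff space and let $C(X)$ be the unital C*-algebra of continuous functions $X \to \mathbb{C}$. Then \[ \mathrm{rc}(C(X)) \;\geq\; \frac{\dim(X) - 7}{2}, \] as an inequality in $[-\infty, \infty]$; in particular $\mathrm{rc}(C(X)) = \infty$ if $\dim(X) = \infty$. The notation is as follows. The covering dimension $\dim(X)$ is the least integer $n \geq -1$ such that every finite open cover of $X$ has an open refinement covering $X$ of order at most $n$, that is, such that every point of $X$ lies in at most $n+1$ members of the refinement; $\dim(X) = \infty$ if there is no such $n$ (and $\dim(\varnothing) = -1$). For a unital C*-algebra $A$ and positive matrices $a \in M_m(A)_+$, $b \in M_n(A)_+$, write $a \precsim b$ ($a$ is Cuntz subequivalent to $b$) if there are $m \times n$ matrices $v_k$ over $A$ with $v_k b v_k^* \to a$ in norm. A normalized lower semicontinuous dimension function on $A$ is a function $s \colon \bigsqcup_n M_n(A)_+ \to [0, \infty)$ such that $s(a \oplus b) = s(a) + s(b)$, such that $a \precsim b$ implies $s(a) \leq s(b)$, such that $s(1_A) = 1$, and such that $s$ is norm lower semicontinuous on $M_n(A)_+$ for every $n$. For $r \geq 0$, the algebra $A$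 has $r$-comparison if for all positive matrices $a, b$ over $A$, whenever $s(a) + r < s(b)$ for every normalized lower semicontinuous dimension function $s$ on $A$, then $a \precsim b$. The radius of comparison is $\mathrm{rc}(A) = \inf \{ r \geq 0 : A \text{ has } r\text{-comparison} \} \in [0, \infty]$, with $\inf \varnothing = \infty$. -/

import Mathlib

open Filter Topology
open scoped NNReal ENNReal ComplexOrder

namespace RadiusComparison

/-! ### Cuntz comparison, dimension functions and the radius of comparison -/

/-- Cuntz subequivalence `a ≾ b` of (positive) square matrices over a C*-algebra `A`, possibly of
different sizes: there is a sequence of rectangular matrices `v k` over `A` such that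
`v k * b * (v k)ᴴ` converges to `a` in norm (the topology of `CStarMatrix` is the one induced by
the C*-norm). -/
def CuntzLE {A : Type*} [CStarAlgebra A] [PartialOrder A] [StarOrderedRing A] {m n : ℕ}
    (a : CStarMatrix (Fin m) (Fin m) A) (b : CStarMatrix (Fin n) (Fin n) A) : Prop :=
  ∃ v : ℕ → CStarMatrix (Fin m) (Fin n) A,
    Tendsto (fun k => v k * b * (v k).conjTranspose) atTop (𝓝 a)

/-- The direct sum `a ⊕ b = diag(a, b)` of two square matrices over `A`. -/
def directSum {A : Type*} [Zero A] {m n : ℕ}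
    (a : CStarMatrix (Fin m) (Fin m) A) (b : CStarMatrix (Fin n) (Fin n) A) :
    CStarMatrix (Fin (m + n)) (Fin (m + n)) A :=
  CStarMatrix.ofMatrix (Matrix.reindex finSumFinEquiv finSumFinEquiv
    (Matrix.fromBlocks (CStarMatrix.ofMatrix.symm a) 0 0 (CStarMatrix.ofMatrix.symm b)))

/-- A normalized lower semicontinuous dimension function on a unital C*-algebra `A`: a function
on the positive matrices over `A` (of all sizes) with values in `[0, ∞)` that is additive on direct
sums, monotone for Cuntz subequivalence, takes the value `1` at the unit of `A`, and is
norm lower semicontinuous on the positive matrices of each size. Only the values at positive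
matrices matter. -/
structure LSCDimensionFunction (A : Type*) [CStarAlgebra A] [PartialOrder A]
    [StarOrderedRing A] where
  /-- The value of the dimension function at a matrix of size `n`. -/
  toFun : ∀ n : ℕ, CStarMatrix (Fin n) (Fin n) A → ℝ≥0
  map_directSum : ∀ (m n : ℕ) (a : CStarMatrix (Fin m) (Fin m) A)
    (b : CStarMatrix (Fin n) (Fin n) A), 0 ≤ a → 0 ≤ b →
      toFun (m + n) (directSum a b) = toFun m a + toFun n b
  mono : ∀ (m n : ℕ) (a : CStarMatrix (Fin m) (Fin m) A) (b : CStarMatrix (Fin n) (Fin n) A),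
    0 ≤ a → 0 ≤ b → CuntzLE a b → toFun m a ≤ toFun n b
  map_one : toFun 1 1 = 1
  lowerSemicontinuousOn : ∀ n : ℕ,
    LowerSemicontinuousOn (toFun n) {a : CStarMatrix (Fin n) (Fin n) A | 0 ≤ a}

/-- `A` has `r`-comparison: for positive matrices `a` and `b` over `A`, if `s a + r < s b` for all
normalized lower semicontinuous dimension functions `s` on `A`, then `a` is Cuntz subequivalent
to `b`. -/
def HasComparison (A : Type*) [CStarAlgebra A] [PartialOrder A] [StarOrderedRing A]
    (r : ℝ≥0) : Prop :=
  ∀ (m n : ℕ) (a : CStarMatrix (Fin m) (Fin m) A) (b : CStarMatrix (Fin n) (Fin n) A),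
    0 ≤ a → 0 ≤ b → (∀ s : LSCDimensionFunction A, s.toFun m a + r < s.toFun n b) → CuntzLE a b

/-- The radius of comparison of a unital C*-algebra `A`: the infimum of all `r ≥ 0` such that `A`
has `r`-comparison, and `∞` if there is no such `r`. -/
noncomputable def radiusOfComparison (A : Type*) [CStarAlgebra A] [PartialOrder A]
    [StarOrderedRing A] : ℝ≥0∞ :=
  ⨅ (r : ℝ≥0) (_ : HasComparison A r), (r : ℝ≥0∞)

/-! ### Covering dimension -/

/-- Every finite open cover of `X` has an open refinement (again a cover of `X`) such that each
point of `X` lies in at most `k` members of the refinement. In the usual terminology, the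
refinement has order at most `k - 1`. -/
def HasRefinementsOfMultiplicityLE (X : Type*) [TopologicalSpace X] (k : ℕ) : Prop :=
  ∀ U : Set (Set X), U.Finite → (∀ u ∈ U, IsOpen u) → ⋃₀ U = Set.univ →
    ∃ V : Set (Set X), (∀ v ∈ V, IsOpen v) ∧ ⋃₀ V = Set.univ ∧
      (∀ v ∈ V, ∃ u ∈ U, v ⊆ u) ∧ ∀ x : X, {v ∈ V | x ∈ v}.encard ≤ k

/-- The covering dimension of `X`: the least integer `n ≥ -1` such that every finite open cover of
`X` has an open refinement of order at most `n` (that is, each point lies in at most `n + 1`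
members), and `∞` if there is no such `n`. Here `n` is written as `k - 1` with `k : ℕ`. The empty
space has dimension `-1`. -/
noncomputable def coveringDim (X : Type*) [TopologicalSpace X] : EReal :=
  ⨅ (k : ℕ) (_ : HasRefinementsOfMultiplicityLE X k), ((k : EReal) - 1)

end RadiusComparison

/-!
Write `X` for the space and suppose that `C(X, ℂ)` has `r`-comparison. The point is that, for
`n > r + 2`, if a continuous `h : X → ℂⁿ` has no zeros on a given closed set, then its restriction
to this set extends to a continuous map `X → ℂⁿ \ {0}`
(`HasComparison.exists_nonvanishing_extension`).

To see this, let the closed set be the zero set of a continuous function `e ≥ 0`, put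
`c = |h|² + e > 0` and `T = c - h h*`, and compare the unit of `C(X, ℂ)` with `T T*`. Pointwise, `T`
has rank at least `n - 1`, and its range is orthogonal to `h` where `e = 0`. As
`c² - T T*` is of the form `q q*` with a single column `q`, `1ₙ ≾ T T* ⊕ 1`, so every normalized
dimension function has value at least `n - 1 > 1 + r` at `T T*`. By `r`-comparison, `1 ≾ T T*`, and this provides a nowhere
vanishing `s : X → ℂⁿ` that is orthogonal to `h` where `e = 0`
(`HasComparison.exists_orthogonal_section`). There, the segment from `h` to `s` avoids the origin,
so `h` is homotopic in `ℂⁿ \ {0}` to the restriction of a map defined on all of `X`, and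
Borsuk's homotopy extension argument applies.

Extension of maps into `ℂⁿ \ {0}` bounds the covering dimension by `2 n - 1`. A partition of unity
subordinate to a cover by `2 n + 1` open sets maps `X` to a simplex of dimension `2 n`, whose
boundary is homotopy equivalent to `ℂⁿ \ {0}`; pushing the map into the boundary, without changing
it where it already lies there, shrinks the cover to one with empty total intersection
(`HasComparison.exists_shrinking_iInter_eq_empty`). Doing this for all
`(2 n + 1)`-element subfamilies of a finite cover in turn brings its multiplicity down to `2 n`
(`hasRefinementsOfMultiplicityLE_of_shrinking`). With `n = ⌊r⌋ + 3` this gives `dim X ≤ 2 r + 5`.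
-/

namespace RadiusComparison

/-! ### Direct sums and Cuntz comparison -/

section CuntzComparison

@[simp]
lemma directSum_castAdd_castAdd {A : Type*} [Zero A] {m n : ℕ} (a : CStarMatrix (Fin m) (Fin m) A)
    (b : CStarMatrix (Fin n) (Fin n) A) (i j : Fin m) :
    directSum a b (Fin.castAdd n i) (Fin.castAdd n j) = a i j := by
  simp [directSum]

@[simp]
lemma directSum_castAdd_natAdd {A : Type*} [Zero A] {m n : ℕ} (a : CStarMatrix (Fin m) (Fin m) A)
    (b : CStarMatrix (Fin n) (Fin n) A) (i : Fin m) (j : Fin n) :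
    directSum a b (Fin.castAdd n i) (Fin.natAdd m j) = 0 := by
  simp [directSum]

@[simp]
lemma directSum_natAdd_castAdd {A : Type*} [Zero A] {m n : ℕ} (a : CStarMatrix (Fin m) (Fin m) A)
    (b : CStarMatrix (Fin n) (Fin n) A) (i : Fin n) (j : Fin m) :
    directSum a b (Fin.natAdd m i) (Fin.castAdd n j) = 0 := by
  simp [directSum]

@[simp]
lemma directSum_natAdd_natAdd {A : Type*} [Zero A] {m n : ℕ} (a : CStarMatrix (Fin m) (Fin m) A)
    (b : CStarMatrix (Fin n) (Fin n) A) (i j : Fin n) :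
    directSum a b (Fin.natAdd m i) (Fin.natAdd m j) = b i j := by
  simp [directSum]

lemma directSum_one_one {A : Type*} [Zero A] [One A] (m n : ℕ) :
    directSum (1 : CStarMatrix (Fin m) (Fin m) A) (1 : CStarMatrix (Fin n) (Fin n) A) = 1 := by
  ext i j
  induction i using Fin.addCases with
  | left i =>
    induction j using Fin.addCases with
    | left j => simp [CStarMatrix.one_apply]
    | right j =>
      rw [directSum_castAdd_natAdd, CStarMatrix.one_apply_ne]
      exact Fin.ne_of_lt (by simp [Fin.lt_def]; omega)
  | right i =>
    induction j using Fin.addCases with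
    | left j =>
      rw [directSum_natAdd_castAdd, CStarMatrix.one_apply_ne]
      exact Fin.ne_of_gt (by simp [Fin.lt_def]; omega)
    | right j => simp [CStarMatrix.one_apply]

lemma cstarMatrix_mul_assoc {A : Type*} [NonUnitalSemiring A] {k l m n : ℕ}
    (a : CStarMatrix (Fin k) (Fin l) A) (b : CStarMatrix (Fin l) (Fin m) A)
    (c : CStarMatrix (Fin m) (Fin n) A) : a * b * c = a * (b * c) :=
  Matrix.mul_assoc (CStarMatrix.ofMatrix.symm a) (CStarMatrix.ofMatrix.symm b)
    (CStarMatrix.ofMatrix.symm c)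

lemma cstarMatrix_conjTranspose_mul {A : Type*} [NonUnitalSemiring A] [StarRing A] {k l m : ℕ}
    (a : CStarMatrix (Fin k) (Fin l) A) (b : CStarMatrix (Fin l) (Fin m) A) :
    (a * b).conjTranspose = b.conjTranspose * a.conjTranspose :=
  Matrix.conjTranspose_mul (CStarMatrix.ofMatrix.symm a) (CStarMatrix.ofMatrix.symm b)

variable {A : Type*} [CStarAlgebra A] [PartialOrder A] [StarOrderedRing A]

/-- An identity `p a p* + q b q* = d` says that `(p q)` conjugates `diag(a, b)` to `d`. -/
lemma cuntzLE_directSum_of_add_eq {k m n : ℕ} {d : CStarMatrix (Fin k) (Fin k) A}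
    {a : CStarMatrix (Fin m) (Fin m) A} {b : CStarMatrix (Fin n) (Fin n) A}
    (p : CStarMatrix (Fin k) (Fin m) A) (q : CStarMatrix (Fin k) (Fin n) A)
    (h : p * a * p.conjTranspose + q * b * q.conjTranspose = d) :
    CuntzLE d (directSum a b) := by
  let v : CStarMatrix (Fin k) (Fin (m + n)) A :=
    CStarMatrix.ofMatrix fun i => Fin.addCases (p i) (q i)
  have hv : v * directSum a b * v.conjTranspose = d := by
    rw [← h]
    ext i j
    have hp (i : Fin k) (l : Fin m) : v i (Fin.castAdd n l) = p i l := by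
      change Fin.addCases (motive := fun _ => A) (p i) (q i) (Fin.castAdd n l) = _
      simp
    have hq (i : Fin k) (l : Fin n) : v i (Fin.natAdd m l) = q i l := by
      change Fin.addCases (motive := fun _ => A) (p i) (q i) (Fin.natAdd m l) = _
      simp
    simp [hp, hq, CStarMatrix.mul_apply, Fin.sum_univ_add]
  exact ⟨fun _ => v, by simp only [hv]; exact tendsto_const_nhds⟩

lemma one_nonneg (n : ℕ) : 0 ≤ (1 : CStarMatrix (Fin n) (Fin n) A) := by
  simpa only [star_one, mul_one] using star_mul_self_nonneg (1 : CStarMatrix (Fin n) (Fin n) A)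

lemma directSum_mul_star_self_nonneg {m n : ℕ} (p : CStarMatrix (Fin m) (Fin m) A)
    (q : CStarMatrix (Fin n) (Fin n) A) : 0 ≤ directSum (p * star p) (q * star q) := by
  convert mul_star_self_nonneg (directSum p q)
  ext i j
  induction i using Fin.addCases <;> induction j using Fin.addCases <;>
    simp [CStarMatrix.mul_apply, CStarMatrix.star_apply, Fin.sum_univ_add]

lemma LSCDimensionFunction.apply_one (s : LSCDimensionFunction A) (n : ℕ) : s.toFun n 1 = n := by
  induction n with
  | zero =>
    have h := s.map_directSum 0 0 1 1 (one_nonneg 0) (one_nonneg 0)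
    rw [directSum_one_one] at h
    simpa using h
  | succ n ih =>
    have h := s.map_directSum n 1 1 1 (one_nonneg n) (one_nonneg 1)
    rw [directSum_one_one, s.map_one, ih] at h
    exact_mod_cast h

end CuntzComparison

/-! ### Nowhere vanishing sections from comparison -/

section Sections

variable {X : Type*} [TopologicalSpace X] [CompactSpace X]

/-- If `1 ≾ T T*`, then some combination `v T` of the rows of `T` vanishes nowhere: otherwise
`v T (v T)*` would have a zero for every `v` and stay at distance at least `1` from `1`. -/
lemma exists_nonvanishing_of_cuntzLE_one {n : ℕ} {T : CStarMatrix (Fin n) (Fin n) C(X, ℂ)}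
    (h : CuntzLE (1 : CStarMatrix (Fin 1) (Fin 1) C(X, ℂ)) (T * T.conjTranspose)) :
    ∃ v : Fin n → C(X, ℂ), ∀ x, ∃ j, ∑ i, v i x * T i j x ≠ 0 := by
  obtain ⟨v, hv⟩ := h
  obtain ⟨k, hk⟩ := ((Metric.tendsto_nhds.mp hv) 1 one_pos).exists
  refine ⟨v k 0, fun x => ?_⟩
  by_contra! hx
  have h1 : (v k * (T * T.conjTranspose) * (v k).conjTranspose) 0 0 x = 0 := by
    have h2 : v k * (T * T.conjTranspose) * (v k).conjTranspose
        = (v k * T) * (v k * T).conjTranspose := by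
      rw [cstarMatrix_conjTranspose_mul, cstarMatrix_mul_assoc, cstarMatrix_mul_assoc,
        cstarMatrix_mul_assoc]
    rw [h2, CStarMatrix.mul_apply, ContinuousMap.sum_apply]
    refine Finset.sum_eq_zero fun j _ => ?_
    have h3 : (v k * T) 0 j x = 0 := by
      rw [CStarMatrix.mul_apply, ContinuousMap.sum_apply]
      exact hx j
    rw [ContinuousMap.mul_apply, h3, zero_mul]
  let D : CStarMatrix (Fin 1) (Fin 1) C(X, ℂ) :=
    v k * (T * T.conjTranspose) * (v k).conjTranspose - 1
  have h2 : ‖D 0 0 x‖ ≤ ‖D‖ :=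
    (ContinuousMap.norm_coe_le_norm (D 0 0) x).trans CStarMatrix.norm_entry_le_norm
  rw [dist_eq_norm] at hk
  have hD : D 0 0 x = 0 - 1 := by
    rw [← h1]
    rfl
  rw [hD] at h2
  simp only [zero_sub, norm_neg, norm_one] at h2
  linarith

open Complex in
/-- If `C(X, ℂ)` has `r`-comparison and `n > r + 2`, then a map `h : X → ℂⁿ` without zeros in the
closed set `{e = 0}` admits a nowhere vanishing `s : X → ℂⁿ` orthogonal to it on this set, in the
bilinear sense `∑ sᵢ hᵢ = 0`. It is obtained by comparing `1` with `T T*` for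
`T = (|h|² + e) - h h*`. -/
lemma HasComparison.exists_orthogonal_section
    {r : ℝ≥0} (hr : HasComparison C(X, ℂ) r) {n : ℕ} (hn : r + 2 < n) (h : Fin n → C(X, ℂ))
    (e : C(X, ℝ)) (he : ∀ x, 0 ≤ e x) (hne : ∀ x, e x = 0 → ∃ i, h i x ≠ 0) :
    ∃ s : Fin n → C(X, ℂ), (∀ x, ∃ i, s i x ≠ 0) ∧
      ∀ x, e x = 0 → ∑ i, s i x * h i x = 0 := by
  let N : C(X, ℝ) := ⟨fun x => ∑ i, ‖h i x‖ ^ 2, by fun_prop⟩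
  have hN (x : X) : ((N x : ℝ) : ℂ) = ∑ i, star (h i x) * h i x := by
    simp [N, ← Complex.conj_mul']
  have hN0 (x : X) : 0 ≤ N x := by
    change 0 ≤ ∑ i, ‖h i x‖ ^ 2
    positivity
  have hc (x : X) : 0 < N x + e x := by
    rcases (he x).lt_or_eq with h1 | h1
    · linarith [hN0 x]
    · obtain ⟨i, hi⟩ := hne x h1.symm
      have : 0 < N x := Finset.sum_pos' (fun i _ => by positivity)
        ⟨i, Finset.mem_univ i, by positivity⟩
      linarith [he x]
  let c : C(X, ℂ) := ⟨fun x => ((N x + e x : ℝ) : ℂ), by fun_prop⟩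
  let d : C(X, ℂ) := ⟨fun x => (((N x + e x)⁻¹ : ℝ) : ℂ),
    continuous_ofReal.comp (Continuous.inv₀ (by fun_prop) fun x => (hc x).ne')⟩
  let w : C(X, ℂ) := ⟨fun x => ((√(N x + 2 * e x) : ℝ) : ℂ), by fun_prop⟩
  let T : CStarMatrix (Fin n) (Fin n) C(X, ℂ) :=
    CStarMatrix.ofMatrix fun i j => (if i = j then c else 0) - h i * star (h j)
  have hT (i j : Fin n) (x : X) :
      T i j x = (if i = j then c x else 0) - h i x * star (h j x) := by
    change ((if i = j then c else 0) - h i * star (h j)) x = _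
    split_ifs <;> simp
  have hB : 0 ≤ T * T.conjTranspose := mul_star_self_nonneg T
  have hBij (i j : Fin n) (x : X) : (T * T.conjTranspose) i j x
      = (if i = j then c x ^ 2 else 0) - (w x) ^ 2 * (h i x * star (h j x)) := by
    have hw : (w x) ^ 2 = 2 * c x - N x := by
      have : (√(N x + 2 * e x)) ^ 2 = N x + 2 * e x :=
        Real.sq_sqrt (by linarith [hN0 x, he x])
      simp only [w, c, ContinuousMap.coe_mk]
      rw [← ofReal_pow, this]
      push_cast
      ring
    have hcc : star (c x) = c x := conj_ofReal _
    have h1 : (T * T.conjTranspose) i j x = ∑ k, T i k x * star (T j k x) := by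
      rw [CStarMatrix.mul_apply, ContinuousMap.sum_apply]
      rfl
    have h2 (k : Fin n) : T i k x * star (T j k x)
        = (if i = k then (if j = k then c x ^ 2 else 0) else 0)
          - (if i = k then c x * (star (h j x) * h k x) else 0)
          - (if j = k then c x * (h i x * star (h k x)) else 0)
          + (h i x * star (h j x)) * (star (h k x) * h k x) := by
      rw [hT, hT]
      split_ifs <;> simp [hcc] <;> ring
    rw [h1, hw, hN, Finset.sum_congr rfl fun k _ => h2 k]
    simp only [Finset.sum_add_distrib, Finset.sum_sub_distrib, ← Finset.mul_sum,
      Finset.sum_ite_eq, Finset.mem_univ, if_true]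
    rcases eq_or_ne i j with rfl | hij
    · simp; ring
    · simp [hij, hij.symm]; ring
  -- `T Tᴴ + q qᴴ = c² • 1` for the column `q = w h`, because `w² = |h|² + 2 e = 2 c - |h|²`; this
  -- gives `1ₙ ≾ T Tᴴ ⊕ 1`.
  have hs (s : LSCDimensionFunction C(X, ℂ)) : (n : ℝ≥0) ≤ s.toFun n (T * T.conjTranspose) + 1 := by
    have hds : 0 ≤ directSum (T * T.conjTranspose) (1 : CStarMatrix (Fin 1) (Fin 1) C(X, ℂ)) := by
      have := directSum_mul_star_self_nonneg T (1 : CStarMatrix (Fin 1) (Fin 1) C(X, ℂ))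
      rwa [star_one, mul_one] at this
    rw [← s.apply_one n, ← s.map_one, ← s.map_directSum _ _ _ _ hB (one_nonneg 1)]
    let P : CStarMatrix (Fin n) (Fin n) C(X, ℂ) :=
      CStarMatrix.ofMatrix fun i j => if i = j then d else 0
    let Q : CStarMatrix (Fin n) (Fin 1) C(X, ℂ) := CStarMatrix.ofMatrix fun i _ => d * w * h i
    refine s.mono _ _ _ _ (one_nonneg n) hds (cuntzLE_directSum_of_add_eq P Q ?_)
    ext i j x
    have hd : star (d x) = d x := conj_ofReal _
    have hw : star (w x) = w x := conj_ofReal _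
    have hcd : d x * c x = 1 := by
      simp only [d, c, ContinuousMap.coe_mk]
      rw [← ofReal_mul, inv_mul_cancel₀ (hc x).ne', ofReal_one]
    rw [CStarMatrix.add_apply, ContinuousMap.add_apply]
    have h1 : (P * (T * T.conjTranspose) * P.conjTranspose) i j x
        = d x * (T * T.conjTranspose) i j x * d x := by
      have hP (i k : Fin n) : P i k = if i = k then d else 0 := rfl
      have hdd : star d = d := by ext y; exact conj_ofReal _
      simp [CStarMatrix.mul_apply (M := P), CStarMatrix.mul_apply (N := P.conjTranspose), hP,
        apply_ite (star : C(X, ℂ) → C(X, ℂ)), hdd]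
    have h2 : (Q * (1 : CStarMatrix (Fin 1) (Fin 1) C(X, ℂ)) * Q.conjTranspose) i j x
        = (d x * w x) ^ 2 * (h i x * star (h j x)) := by
      have hQ (i : Fin n) (k : Fin 1) : Q i k = d * w * h i := rfl
      simp only [CStarMatrix.mul_apply, Finset.univ_unique, Finset.sum_singleton, hQ,
        CStarMatrix.one_apply_eq, mul_one, CStarMatrix.conjTranspose_apply, star_mul,
        ContinuousMap.mul_apply, ContinuousMap.star_apply, hd, hw]
      ring
    rw [h1, h2, hBij, CStarMatrix.one_apply]
    split_ifs
    · rw [ContinuousMap.one_apply]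
      linear_combination (d x * c x + 1) * hcd
    · rw [ContinuousMap.zero_apply]
      ring
  have hcomp := hr 1 n 1 (T * T.conjTranspose)
    (one_nonneg 1) hB fun s => by
      rw [s.map_one]
      have h1 : r + 2 < s.toFun n (T * T.conjTranspose) + 1 := hn.trans_le (hs s)
      refine lt_of_add_lt_add_right (a := 1) (lt_of_le_of_lt (le_of_eq ?_) h1)
      ring
  -- The witness is the row `v T`; where `e = 0`, it kills `h` because `T h = (c - |h|²) h = e h`.
  obtain ⟨v, hv⟩ := exists_nonvanishing_of_cuntzLE_one hcomp
  refine ⟨fun j => ∑ i, v i * T i j, fun x => ?_, fun x hx => ?_⟩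
  · simpa using hv x
  · have h1 (i : Fin n) : ∑ j, T i j x * h j x = 0 := by
      have h2 (j : Fin n) : T i j x * h j x
          = (if i = j then c x * h i x else 0) - h i x * (star (h j x) * h j x) := by
        rw [hT]
        split_ifs with hij
        · subst hij; ring
        · ring
      rw [Finset.sum_congr rfl fun j _ => h2 j, Finset.sum_sub_distrib, ← Finset.mul_sum, ← hN]
      simp [c, hx, mul_comm]
    simp only [ContinuousMap.sum_apply, ContinuousMap.mul_apply, Finset.sum_mul]
    rw [Finset.sum_comm]
    refine Finset.sum_eq_zero fun i _ => ?_
    rw [← mul_zero (v i x), ← h1 i, Finset.mul_sum]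
    exact Finset.sum_congr rfl fun j _ => mul_assoc _ _ _

end Sections

/-! ### Extension of maps and covering dimension -/

section Dimension

variable {X : Type*} [TopologicalSpace X]

/-- If `C(X, ℂ)` has `r`-comparison and `n > r + 2`, then the restriction of `h : X → ℂⁿ` to a
zero set `{e = 0}` on which `h` has no zeros extends to a nowhere vanishing map on `X`. -/
lemma HasComparison.exists_nonvanishing_extension [CompactSpace X] [T2Space X]
    {r : ℝ≥0} (hr : HasComparison C(X, ℂ) r) {n : ℕ} (hn : r + 2 < n) (h : Fin n → C(X, ℂ))
    (e : C(X, ℝ)) (he : ∀ x, 0 ≤ e x) (hne : ∀ x, e x = 0 → ∃ i, h i x ≠ 0) :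
    ∃ g : Fin n → C(X, ℂ), (∀ x, ∃ i, g i x ≠ 0) ∧ ∀ x, e x = 0 → ∀ i, g i x = h i x := by
  obtain ⟨s, hs, hsh⟩ := hr.exists_orthogonal_section hn h e he hne
  -- Zeros of the straight-line homotopy from `h` to `star s`; the conjugate appears because
  -- `∑ sᵢ hᵢ = 0` is orthogonality of `h` and `star s` for the Hermitian inner product.
  let Z : Set (X × unitInterval) :=
    {p | ∀ i, (1 - (p.2 : ℂ)) * h i p.1 + (p.2 : ℂ) * star (s i p.1) = 0}
  have hZ : IsClosed Z := by
    simp only [Z, Set.ofPred_forall]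
    refine isClosed_iInter fun i => isClosed_eq ?_ continuous_const
    have : Continuous fun p : X × unitInterval => ((p.2 : ℝ) : ℂ) :=
      Complex.continuous_ofReal.comp (by fun_prop)
    fun_prop
  have hC : IsClosed (Prod.fst '' Z) := (hZ.isCompact.image continuous_fst).isClosed
  have hA : IsClosed {x | e x = 0} := isClosed_eq (by fun_prop) continuous_const
  have hdisj : Disjoint {x | e x = 0} (Prod.fst '' Z) := by
    rw [Set.disjoint_left]
    rintro _ hx ⟨⟨x, t⟩, hp, rfl⟩
    replace hx : e x = 0 := hx
    have h1 : (t : ℂ) * ∑ i, s i x * star (s i x) = 0 := by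
      have h2 : ∑ i, s i x * ((1 - (t : ℂ)) * h i x + (t : ℂ) * star (s i x)) = 0 :=
        Finset.sum_eq_zero fun i _ => by rw [hp i, mul_zero]
      have h3 : ∑ i, s i x * ((1 - (t : ℂ)) * h i x + (t : ℂ) * star (s i x))
          = (1 - (t : ℂ)) * ∑ i, s i x * h i x + (t : ℂ) * ∑ i, s i x * star (s i x) := by
        rw [Finset.mul_sum, Finset.mul_sum, ← Finset.sum_add_distrib]
        exact Finset.sum_congr rfl fun i _ => by ring
      rwa [h3, hsh x hx, mul_zero, zero_add] at h2
    have h4 : ∑ i, s i x * star (s i x) ≠ 0 := by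
      obtain ⟨i, hi⟩ := hs x
      have h5 : 0 < ∑ i, ‖s i x‖ ^ 2 := Finset.sum_pos' (fun i _ => by positivity)
        ⟨i, Finset.mem_univ i, by positivity⟩
      have h6 : ∑ i, s i x * star (s i x) = ((∑ i, ‖s i x‖ ^ 2 : ℝ) : ℂ) := by
        simp [Complex.mul_conj']
      rw [h6]
      exact_mod_cast h5.ne'
    have ht : (t : ℂ) = 0 := (mul_eq_zero.mp h1).resolve_right h4
    obtain ⟨i, hi⟩ := hne x hx
    have := hp i
    simp only [ht, sub_zero, one_mul, zero_mul, add_zero] at this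
    exact hi this
  obtain ⟨u, hu0, hu1, hu⟩ := exists_continuous_zero_one_of_isClosed hA hC hdisj
  -- Run the homotopy up to time `u`, which is `1` at every point where the homotopy has a zero.
  let u' : C(X, ℂ) := ⟨fun x => ((u x : ℝ) : ℂ), by fun_prop⟩
  refine ⟨fun i => (1 - u') * h i + u' * star (s i), fun x => ?_, fun x hx i => ?_⟩
  · by_contra! h0
    have hx : x ∈ Prod.fst '' Z := ⟨(x, ⟨u x, hu x⟩), fun i => h0 i, rfl⟩
    have hux : u' x = 1 := by simp [u', hu1 hx]
    obtain ⟨i, hi⟩ := hs x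
    exact hi (by simpa [hux] using h0 i)
  · have hux : u' x = 0 := by simp [u', hu0 hx]
    simp [hux]

/-- If `C(X, ℂ)` has `r`-comparison and `n > r + 2`, then every open cover of `X` by `2 n + 1` sets
has a shrinking with empty total intersection. The index type is chosen so that `ℂⁿ`, by real and
imaginary parts, is `ℝ^(2 n + 1)` modulo the diagonal. -/
lemma HasComparison.exists_shrinking_iInter_eq_empty [CompactSpace X] [T2Space X]
    {r : ℝ≥0} (hr : HasComparison C(X, ℂ) r) {n : ℕ} (hn : r + 2 < n)
    (U : Option (Fin n ⊕ Fin n) → Set X) (hU : ∀ i, IsOpen (U i)) (hcov : ⋃ i, U i = Set.univ) :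
    ∃ V : Option (Fin n ⊕ Fin n) → Set X, (∀ i, IsOpen (V i)) ∧ (∀ i, V i ⊆ U i) ∧
      ⋃ i, V i = Set.univ ∧ ⋂ i, V i = ∅ := by
  obtain ⟨φ, hφ⟩ := PartitionOfUnity.exists_isSubordinate isClosed_univ U hU hcov.ge
  -- `e` vanishes exactly where the partition of unity takes values in the boundary of the simplex.
  let e : C(X, ℝ) := ⟨fun x => Finset.univ.inf' Finset.univ_nonempty fun i => φ i x, by fun_prop⟩
  have heφ (x i) : e x ≤ φ i x := Finset.inf'_le _ (Finset.mem_univ i)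
  have he (x) : 0 ≤ e x := Finset.le_inf' Finset.univ_nonempty _ fun i _ => φ.nonneg i x
  -- The class of `φ` modulo the diagonal, in the coordinates in which the component `none` is `0`.
  let h (i : Fin n) : C(X, ℂ) :=
    ⟨fun x => ⟨φ (some (.inl i)) x - φ none x, φ (some (.inr i)) x - φ none x⟩, by
      simp only [Complex.mk_eq_add_mul_I]
      fun_prop⟩
  have hsum (x) : ∃ i, φ i x ≠ 0 := by
    obtain ⟨i, hi⟩ := φ.exists_pos (Set.mem_univ x)
    exact ⟨i, hi.ne'⟩
  have hne (x) (hx : e x = 0) : ∃ i, h i x ≠ 0 := by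
    by_contra! h0
    have hall (i) : φ i x = φ none x := by
      match i with
      | none => rfl
      | some (.inl i) => exact sub_eq_zero.mp (congrArg Complex.re (h0 i))
      | some (.inr i) => exact sub_eq_zero.mp (congrArg Complex.im (h0 i))
    obtain ⟨i, hi⟩ := hsum x
    obtain ⟨j, -, hj⟩ := Finset.exists_mem_eq_inf' Finset.univ_nonempty fun i => φ i x
    have hj' : e x = φ j x := hj
    exact hi (by rw [hall i, ← hall j, ← hj', hx])
  obtain ⟨g, hg, hgh⟩ := hr.exists_nonvanishing_extension hn h e he hne
  -- The lift of `g` with component `none` equal to `0`. Subtracting its minimum `μ` gives a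
  -- nonnegative lift that has a zero component everywhere and equals `φ` where `e = 0`.
  let γ : Option (Fin n ⊕ Fin n) → C(X, ℝ)
    | none => 0
    | some (.inl i) => ⟨fun x => (g i x).re, by fun_prop⟩
    | some (.inr i) => ⟨fun x => (g i x).im, by fun_prop⟩
  let μ : C(X, ℝ) := ⟨fun x => Finset.univ.inf' Finset.univ_nonempty fun i => γ i x, by fun_prop⟩
  have hμγ (x i) : μ x ≤ γ i x := Finset.inf'_le _ (Finset.mem_univ i)
  have hμ (x) : ∃ i, μ x = γ i x := by
    obtain ⟨j, -, hj⟩ := Finset.exists_mem_eq_inf' Finset.univ_nonempty fun i => γ i x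
    exact ⟨j, hj⟩
  have hγφ (x) (hx : e x = 0) (i) : γ i x = φ i x - φ none x := by
    match i with
    | none => simp [γ]
    | some (.inl i) => exact congrArg Complex.re (hgh x hx i)
    | some (.inr i) => exact congrArg Complex.im (hgh x hx i)
  refine ⟨fun i => {x | μ x < γ i x}, fun i => isOpen_lt (by fun_prop) (by fun_prop),
    fun i x hx => ?_, ?_, ?_⟩
  · by_contra hxU
    have hφ0 : φ i x = 0 := by
      by_contra h0
      exact hxU (hφ i (subset_tsupport _ h0))
    have hx0 : e x = 0 := le_antisymm ((heφ x i).trans_eq hφ0) (he x)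
    obtain ⟨j, hj⟩ := hμ x
    have hx' : μ x < γ i x := hx
    rw [hj, hγφ x hx0, hγφ x hx0, hφ0] at hx'
    linarith [φ.nonneg j x]
  · rw [Set.eq_univ_iff_forall]
    intro x
    by_contra hx
    simp only [Set.mem_iUnion, Set.mem_ofPred_eq, not_exists, not_lt] at hx
    have hall (i) : γ i x = 0 :=
      le_antisymm ((hx i).trans (hμγ x none)) ((hx none).trans (hμγ x i))
    obtain ⟨i, hi⟩ := hg x
    exact hi (Complex.ext (hall (some (.inl i))) (hall (some (.inr i))))
  · rw [Set.eq_empty_iff_forall_notMem]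
    intro x hx
    obtain ⟨j, hj⟩ := hμ x
    exact (Set.mem_iInter.mp hx j).ne hj

/-- If covers indexed by `κ` have shrinkings with empty total intersection, then for a subfamily of
the size of `κ` of any finite cover, the cover can be shrunk so that this subfamily has empty
intersection. -/
lemma exists_shrinking_of_finset {κ ι : Type*} [Fintype κ] [Nonempty κ] [Fintype ι] [DecidableEq ι]
    (H : ∀ U : κ → Set X, (∀ i, IsOpen (U i)) → ⋃ i, U i = Set.univ →
      ∃ V : κ → Set X, (∀ i, IsOpen (V i)) ∧ (∀ i, V i ⊆ U i) ∧
        ⋃ i, V i = Set.univ ∧ ⋂ i, V i = ∅)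
    (U : ι → Set X) (hU : ∀ i, IsOpen (U i)) (hcov : ⋃ i, U i = Set.univ)
    (S : Finset ι) (hS : S.card = Fintype.card κ) :
    ∃ V : ι → Set X, (∀ i, IsOpen (V i)) ∧ (∀ i, V i ⊆ U i) ∧ ⋃ i, V i = Set.univ ∧
      ⋂ i ∈ S, V i = ∅ := by
  let f : κ ≃ S := Fintype.equivOfCardEq (by simp [hS])
  -- Adding to each member of the subfamily the union `W` of the remaining sets yields a cover.
  let W : Set X := ⋃ i ∈ Sᶜ, U i
  have hW : IsOpen W := isOpen_biUnion fun i _ => hU i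
  obtain ⟨V, hVo, hVU, hVc, hVe⟩ := H (fun k => U (f k) ∪ W) (fun k => (hU _).union hW) (by
    rw [Set.eq_univ_iff_forall] at hcov ⊢
    intro x
    obtain ⟨i, hi⟩ := Set.mem_iUnion.mp (hcov x)
    rw [Set.mem_iUnion]
    by_cases hiS : i ∈ S
    · exact ⟨f.symm ⟨i, hiS⟩, Or.inl (by simpa using hi)⟩
    · exact ⟨Classical.arbitrary κ, Or.inr
        (Set.mem_biUnion (Finset.mem_coe.mpr (Finset.mem_compl.mpr hiS)) hi)⟩)
  refine ⟨fun i => if hi : i ∈ S then V (f.symm ⟨i, hi⟩) ∩ U i else U i, fun i => ?_, fun i => ?_,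
    ?_, ?_⟩
  · dsimp only
    split_ifs
    exacts [(hVo _).inter (hU i), hU i]
  · dsimp only
    split_ifs
    exacts [Set.inter_subset_right, subset_rfl]
  · rw [Set.eq_univ_iff_forall] at hVc ⊢
    intro x
    obtain ⟨k, hk⟩ := Set.mem_iUnion.mp (hVc x)
    rw [Set.mem_iUnion]
    rcases hVU k hk with h | h
    · exact ⟨f k, by simp [hk, h]⟩
    · simp only [W, Set.mem_iUnion, Finset.mem_compl] at h
      obtain ⟨i, hi, hx⟩ := h
      exact ⟨i, by simp [hi, hx]⟩
  · rw [Set.eq_empty_iff_forall_notMem] at hVe ⊢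
    intro x hx
    refine hVe x (Set.mem_iInter.mpr fun k => ?_)
    have := Set.mem_iInter₂.mp hx (f k) (f k).2
    simp only [Finset.coe_mem, dite_true, Subtype.coe_eta, Equiv.symm_apply_apply] at this
    exact this.1

/-- A space has refinements of multiplicity at most `m` if every open cover by `m + 1` sets has a
shrinking with empty total intersection. -/
lemma hasRefinementsOfMultiplicityLE_of_shrinking {κ : Type*} [Fintype κ] [Nonempty κ] {m : ℕ}
    (hκ : Fintype.card κ = m + 1)
    (H : ∀ U : κ → Set X, (∀ i, IsOpen (U i)) → ⋃ i, U i = Set.univ →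
      ∃ V : κ → Set X, (∀ i, IsOpen (V i)) ∧ (∀ i, V i ⊆ U i) ∧
        ⋃ i, V i = Set.univ ∧ ⋂ i, V i = ∅) :
    HasRefinementsOfMultiplicityLE X m := by
  classical
  intro 𝒰 hfin hopen hcov
  have := hfin.fintype
  -- Shrinking again keeps the intersections that are already empty, so the subfamilies of the
  -- size of `κ` can be treated one after the other.
  have key (P : Finset (Finset 𝒰)) (hP : ∀ S ∈ P, S.card = Fintype.card κ) :
      ∃ V : 𝒰 → Set X, (∀ i, IsOpen (V i)) ∧ (∀ i, V i ⊆ i) ∧ ⋃ i, V i = Set.univ ∧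
        ∀ S ∈ P, ⋂ i ∈ S, V i = ∅ := by
    induction P using Finset.induction_on with
    | empty =>
      exact ⟨fun i => i, fun i => hopen _ i.2, fun i => subset_rfl,
        by rw [← Set.sUnion_eq_iUnion, hcov], by simp⟩
    | insert S P _ ih =>
      obtain ⟨V, hVo, hVU, hVc, hVe⟩ := ih fun S hS => hP S (Finset.mem_insert_of_mem hS)
      obtain ⟨V', hVo', hVU', hVc', hVe'⟩ :=
        exists_shrinking_of_finset H V hVo hVc S (hP S (Finset.mem_insert_self S P))
      refine ⟨V', hVo', fun i => (hVU' i).trans (hVU i), hVc', fun S' hS' => ?_⟩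
      rcases Finset.mem_insert.mp hS' with rfl | hS'
      · exact hVe'
      · rw [← Set.subset_empty_iff, ← hVe S' hS']
        exact Set.iInter₂_mono fun i _ => hVU' i
  obtain ⟨V, hVo, hVU, hVc, hVe⟩ := key (Finset.univ.filter fun S => S.card = Fintype.card κ)
    fun S hS => (Finset.mem_filter.mp hS).2
  refine ⟨Set.range V, ?_, by rwa [Set.sUnion_range], ?_, fun x => ?_⟩
  · rintro _ ⟨i, rfl⟩
    exact hVo i
  · rintro _ ⟨i, rfl⟩
    exact ⟨i, i.2, hVU i⟩
  · let F : Finset 𝒰 := Finset.univ.filter fun i => x ∈ V i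
    have hF : F.card ≤ m := by
      by_contra! hlt
      obtain ⟨S, hSF, hS⟩ := Finset.exists_subset_card_eq (show Fintype.card κ ≤ F.card by omega)
      have hx : x ∈ ⋂ i ∈ S, V i :=
        Set.mem_iInter₂.mpr fun i hi => (Finset.mem_filter.mp (hSF hi)).2
      rw [hVe S (by simp [hS])] at hx
      exact hx
    have hsub : {v ∈ Set.range V | x ∈ v} ⊆ V '' (F : Set 𝒰) := by
      rintro _ ⟨⟨i, rfl⟩, hx⟩
      exact ⟨i, by simpa [F] using hx, rfl⟩
    calc {v ∈ Set.range V | x ∈ v}.encard ≤ (V '' (F : Set 𝒰)).encard := Set.encard_le_encard hsub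
      _ ≤ (F : Set 𝒰).encard := Set.encard_image_le _ _
      _ = F.card := Set.encard_coe_eq_coe_finsetCard F
      _ ≤ m := by exact_mod_cast hF

/-- The bound comes from `dim X ≤ 2 n - 1` for `n = ⌊r⌋ + 3`, the least integer greater than
`r + 2`. -/
lemma HasComparison.coveringDim_le [CompactSpace X] [T2Space X]
    {r : ℝ≥0} (hr : HasComparison C(X, ℂ) r) : coveringDim X ≤ (2 * r + 5 : ℝ) := by
  have hn : r + 2 < (⌊r⌋₊ + 3 : ℕ) := by
    have := Nat.lt_floor_add_one r
    push_cast
    calc r + 2 < ⌊r⌋₊ + 1 + 2 := by gcongr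
      _ = _ := by ring
  have href : HasRefinementsOfMultiplicityLE X (2 * (⌊r⌋₊ + 3)) :=
    hasRefinementsOfMultiplicityLE_of_shrinking (by simp; ring) fun U =>
      hr.exists_shrinking_iInter_eq_empty hn U
  refine (iInf₂_le _ href).trans ?_
  have h1 : (⌊r⌋₊ : ℝ) ≤ r := by exact_mod_cast Nat.floor_le zero_le
  have h2 (k : ℕ) : (k : EReal) - 1 = ((k - 1 : ℝ) : EReal) := by
    rw [EReal.coe_sub]
    rfl
  rw [h2, EReal.coe_le_coe_iff]
  push_cast
  linarith

end Dimension

end RadiusComparison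

theorem mainTheorem1 (X : Type*) [TopologicalSpace X] [CompactSpace X] [T2Space X] :
    (RadiusComparison.coveringDim X - 7) / 2 ≤
      ((RadiusComparison.radiusOfComparison C(X, ℂ) : ENNReal) : EReal) := by
  -- Truncating the left side at `0` turns the claim into a lower bound for an infimum in `ℝ≥0∞`.
  have key : ((RadiusComparison.coveringDim X - 7) / 2).toENNReal ≤
      RadiusComparison.radiusOfComparison C(X, ℂ) := by
    refine le_iInf₂ fun r hr => ?_
    have h1 : (RadiusComparison.coveringDim X - 7) / 2 ≤ (r : ℝ) := by
      rw [EReal.div_le_iff_le_mul (by norm_num) (by decide)]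
      refine (EReal.sub_le_sub hr.coveringDim_le le_rfl).trans ?_
      have : ((2 * r + 5 : ℝ) : EReal) - 7 = ((2 * r + 5 - 7 : ℝ) : EReal) := by norm_cast
      rw [this, show (2 : EReal) = ((2 : ℝ) : EReal) from rfl, ← EReal.coe_mul,
        EReal.coe_le_coe_iff]
      linarith
    refine (EReal.toENNReal_le_toENNReal h1).trans_eq ?_
    simp
  exact le_trans (by rw [EReal.coe_toENNReal_eq_max]; exact le_max_right 0 _)
    (EReal.coe_ennreal_le_coe_ennreal_iff.mpr key)
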